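/- Let $X$ be a Banach space over $\mathbb K=\mathbb R$ or $\mathbb C$ in which $\ell_\infty$ is finitely representable, i.e. for every $\varepsilon>0$ and every $n\in\mathbb N$ there are $e_1,\dots,e_n\in X$ with $\|e_j\|=1$ such that $$(1-\varepsilon)\max_{j}|b_j|\le\Big\|\sum_{j=1}^n b_je_j\Big\|\le(1+\varepsilon)\max_{j}|b_j|\qquad\text{for all } b_1,\dots,b_n\in\mathbb K .$$ A matrix of weights is an infinite matrix $P=(p_{n,m})_{n,m\ge1}$ of non-negative real numbers with only finitely many non-zero entries in each row, such that $\sum_{m=1}^\infty p_{n,m}=1$ for every $n$ and $\lim_{n\to\infty}p_{n,m}=0$ for every $m$. A sequence $(x_n)$ in $X$ is weakly $(P,1)$-convergent to $0$ if $\lim_{n\to\infty}\sum_{m=1}^\infty p_{n,m}|f(x_m)|=0$ for every $f\in X^*$. The point $0$ is a weak cluster point of $(x_n)$ if every weak neighbourhood of $0$ contains $x_n$ for infinitely many $n$. Then for every sequence of real numbers $a_n>0$ the following are equivalent: 1. there are a sequence $x_n\in X$ with $\|x_n\|=a_n$ for all $n$ and a matrix of weights $P$ such that $(x_n)$ is weakly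 $(P,1)$-convergent to $0$; 2. there is a sequence $x_n\in X$ with $\|x_n\|=a_n$ for all $n$ having $0$ as a weak cluster point; 3. $\sum_{n=1}^\infty a_n^{-1}=\infty$. -/

import Mathlib

open Filter Topology

namespace WeakCluster

/-- `ℓ_∞` is finitely representable in `X`: for every `ε > 0` and every `n` there are unit vectors
`e_1, …, e_n` in `X` with
`(1 - ε) max |b_j| ≤ ‖∑ b_j e_j‖ ≤ (1 + ε) max |b_j|` for all scalars `b_1, …, b_n`.
(The norm of `b : Fin n → 𝕜` is the maximum norm.) -/
def LinftyFinitelyRepresentable (𝕜 : Type*) [RCLike 𝕜] (X : Type*) [NormedAddCommGroup X]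
    [NormedSpace 𝕜 X] : Prop :=
  ∀ ε : ℝ, 0 < ε → ∀ n : ℕ, ∃ e : Fin n → X, (∀ j, ‖e j‖ = 1) ∧
    ∀ b : Fin n → 𝕜,
      (1 - ε) * ‖b‖ ≤ ‖∑ j, b j • e j‖ ∧ ‖∑ j, b j • e j‖ ≤ (1 + ε) * ‖b‖

/-- A matrix of weights: an infinite matrix of non-negative numbers with finite rows, each row
having sum `1` and each column tending to `0`. -/
structure IsWeightMatrix (P : ℕ → ℕ → ℝ) : Prop where
  nonneg : ∀ n m, 0 ≤ P n m
  finite_rows : ∀ n, {m | P n m ≠ 0}.Finite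
  row_sum : ∀ n, ∑' m, P n m = 1
  column_tendsto : ∀ m, Tendsto (fun n => P n m) atTop (𝓝 0)

/-- `P`-convergence to `0` of a sequence of reals (used for matrices `P` with finite rows, so that
the inner sums are finite). -/
def PConvergesToZero (P : ℕ → ℕ → ℝ) (a : ℕ → ℝ) : Prop :=
  Tendsto (fun n => ∑' m, P n m * a m) atTop (𝓝 0)

/-- Weak `(P, p)`-convergence of `x` to `0`: for every continuous linear functional `f`
the sequence `|f (x n)| ^ p` is `P`-convergent to `0`. -/
def WeaklyPConvergesToZero (𝕜 : Type*) [RCLike 𝕜] {X : Type*} [NormedAddCommGroup X]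
    [NormedSpace 𝕜 X] (P : ℕ → ℕ → ℝ) (p : ℝ) (x : ℕ → X) : Prop :=
  ∀ f : X →L[𝕜] 𝕜, PConvergesToZero P (fun n => ‖f (x n)‖ ^ p)

/-- `0` is a weak cluster point of the sequence `x`: every weak neighbourhood of `0` contains
`x n` for infinitely many `n`. -/
def HasZeroAsWeakClusterPoint (𝕜 : Type*) [RCLike 𝕜] {X : Type*} [NormedAddCommGroup X]
    [NormedSpace 𝕜 X] (x : ℕ → X) : Prop :=
  MapClusterPt (0 : WeakSpace 𝕜 X) atTop (fun n => toWeakSpace 𝕜 X (x n))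

end WeakCluster

/-!
The three properties are shown to imply one another cyclically.

* Weak `(P, 1)`-convergence gives a weak cluster point: if some weak neighbourhood of `0`, given by
  finitely many functionals `f`, missed all but finitely many `x n`, then `∑ f, |f (x n)|` would be
  bounded below for all large `n`, and so would its `P`-means, because the rows of `P` have sum `1`
  and the columns tend to `0`.

* A weak cluster point forces `∑ (a n)⁻¹ = ∞`: this is a plank theorem in the spirit of K. Ball. If
  `∑ (a n)⁻¹ < ∞`, there is a single functional `f` with `|f (x n)| ≥ 1 / 2` for all `n`, so that
  `0` is not a weak cluster point. By the Banach–Alaoglu theorem it suffices to treat finitely many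
  `n`, with a bound on `‖f‖` that does not depend on their number. Let `g j` be a norming functional
  of `x j` and look for `f = ∑ j, c j • g j` with small `∑ j, |c j|`. If the matrix
  `A i j = re (g j (x i / ‖x i‖))` were symmetric, Bang's choice of signs (`exists_bang_signs`)
  would give `c`. In general, let `B` be `A` with its columns scaled by `√(‖x j‖⁻¹)`. Maximizing a
  suitable product of diagonal entries of `B * U` over all contractions `U` of a Euclidean space
  makes `B * U` symmetric up to a positive scaling of its rows and keeps its diagonal large
  (`exists_symmetrizing_contraction`); now Bang's lemma applies, and the Cauchy–Schwarz inequality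
  bounds `∑ j, |c j|` (`exists_sum_abs_le_forall_le_abs_sum`).

* If `∑ (a n)⁻¹ = ∞`, then `x` and `P` exist: cut `ℕ` into consecutive blocks on which the sums of
  `(a n)⁻¹` tend to infinity, let `x n = a n • e n` with `e` a copy of the basis of `ℓ_∞` in each
  block, and take the weights proportional to `(a n)⁻¹` on each block. A functional `f` satisfies
  `∑ |f (e n)| ≤ 2 ‖f‖` over a block, so the `P`-means of `|f (x n)|` are at most `2 ‖f‖` divided by
  the sum of the block.
-/

namespace WeakCluster

open scoped InnerProductSpace

/-! ### Symmetrization by a contraction and Bang's lemma -/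

section Plank

variable {ι : Type*} [Fintype ι] {E : Type*} [NormedAddCommGroup E] [InnerProductSpace ℝ E]

/-- Bang's lemma: for a symmetric matrix, maximizing the quadratic form over all sign changes of
the vector `τ` makes every coordinate of the image at least as large as its diagonal part. -/
theorem exists_bang_signs (H : ι → ι → ℝ) (hH : ∀ i j, H i j = H j i) (τ : ι → ℝ) :
    ∃ t : ι → ℝ, (∀ i, t i ^ 2 = τ i ^ 2) ∧ ∀ i, H i i * t i ^ 2 ≤ t i * ∑ j, H i j * t j := by
  classical
  obtain ⟨ε, hε⟩ := Finite.exists_max fun ε : ι → ℤˣ =>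
    ∑ i, ∑ j, H i j * (((ε i : ℤ) : ℝ) * τ i) * (((ε j : ℤ) : ℝ) * τ j)
  have hsq : ∀ u : ℤˣ, (((u : ℤ) : ℝ)) ^ 2 = 1 := fun u => by
    rcases Int.units_eq_one_or u with rfl | rfl <;> simp
  refine ⟨fun i => ((ε i : ℤ) : ℝ) * τ i, fun i => by rw [mul_pow, hsq, one_mul], fun k => ?_⟩
  have h := hε (Function.update ε k (-ε k))
  set t : ι → ℝ := fun i => ((ε i : ℤ) : ℝ) * τ i with ht
  -- flipping the sign of the `k`-th coordinate subtracts `2 * t k` times the `k`-th basis vector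
  have hflip : ∀ i, (((Function.update ε k (-ε k) i : ℤˣ) : ℤ) : ℝ) * τ i
      = t i - (if i = k then 2 * t k else 0) := by
    intro i
    by_cases hik : i = k
    · subst hik; simp [ht]; ring
    · simp [ht, hik]
  simp only [hflip] at h
  change _ ≤ ∑ i, ∑ j, H i j * t i * t j at h
  have e : ∑ i, ∑ j, H i j * (t i - (if i = k then 2 * t k else 0))
        * (t j - (if j = k then 2 * t k else 0))
      = ∑ i, ∑ j, H i j * t i * t j - 2 * t k * (∑ j, H k j * t j)
        - 2 * t k * (∑ j, H j k * t j) + 4 * H k k * t k ^ 2 := by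
    have : ∀ i j, H i j * (t i - (if i = k then 2 * t k else 0))
        * (t j - (if j = k then 2 * t k else 0)) = H i j * t i * t j
        - (if i = k then 2 * t k * (H i j * t j) else 0)
        - (if j = k then 2 * t k * (H i j * t i) else 0)
        + (if i = k then (if j = k then 4 * H i j * t k ^ 2 else 0) else 0) := by
      intro i j
      split_ifs <;> ring
    simp only [this, Finset.sum_add_distrib, Finset.sum_sub_distrib, Finset.sum_ite_irrel,
      Finset.sum_const_zero, Finset.sum_ite_eq', Finset.mem_univ, if_true, Finset.mul_sum]
  have e' : ∑ j, H j k * t j = ∑ j, H k j * t j := by simp only [hH k]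
  rw [e, e'] at h
  change H k k * t k ^ 2 ≤ t k * ∑ j, H k j * t j
  linarith

/-- For a skew contraction `T`, the operators `(1 + θ ^ 2) ^ (-1 / 2) • (1 + θ • T)` are
contractions. They serve as a substitute for the rotations `exp (θ • T)`. -/
theorem norm_smul_id_add_smul_le_one (T : E →L[ℝ] E) (hskew : ∀ y, ⟪y, T y⟫_ℝ = 0)
    (hT : ∀ y, ‖T y‖ ≤ ‖y‖) (θ : ℝ) :
    ‖(√(1 + θ ^ 2))⁻¹ • (ContinuousLinearMap.id ℝ E + θ • T)‖ ≤ 1 := by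
  refine ContinuousLinearMap.opNorm_le_bound _ zero_le_one fun y => ?_
  have hpos : 0 < √(1 + θ ^ 2) := Real.sqrt_pos.2 (by positivity)
  have h : ‖y + θ • T y‖ ≤ √(1 + θ ^ 2) * ‖y‖ := by
    refine abs_le_of_sq_le_sq' ?_ (by positivity) |>.2
    rw [norm_add_sq_real, inner_smul_right, hskew, mul_pow, Real.sq_sqrt (by positivity),
      norm_smul, mul_pow, Real.norm_eq_abs, sq_abs]
    nlinarith [mul_le_mul_of_nonneg_left (pow_le_pow_left₀ (norm_nonneg _) (hT y) 2) (sq_nonneg θ)]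
  simp only [smul_apply, add_apply, ContinuousLinearMap.id_apply, norm_smul, norm_inv,
    Real.norm_eq_abs, abs_of_pos hpos, one_mul]
  rw [inv_mul_le_iff₀ hpos]
  exact h

/-- The quarter turn of the plane spanned by `e i` and `e j`, extended by zero. -/
theorem exists_skew_contraction (e : OrthonormalBasis ι ℝ E) {i j : ι} (hij : i ≠ j) :
    ∃ T : E →L[ℝ] E, (∀ y, ⟪y, T y⟫_ℝ = 0) ∧ (∀ y, ‖T y‖ ≤ ‖y‖) ∧
      T (e i) = e j ∧ T (e j) = -e i ∧ ∀ k, k ≠ i → k ≠ j → T (e k) = 0 := by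
  classical
  have ho : ∀ k l, ⟪e k, e l⟫_ℝ = if k = l then 1 else 0 :=
    orthonormal_iff_ite.1 e.orthonormal
  refine ⟨(innerSL ℝ (e i)).smulRight (e j) - (innerSL ℝ (e j)).smulRight (e i),
    fun y => ?_, fun y => ?_, ?_, ?_, fun k hki hkj => ?_⟩
  · simp [inner_sub_right, inner_smul_right, real_inner_comm y]
    ring
  · refine abs_le_of_sq_le_sq' ?_ (norm_nonneg _) |>.2
    have h1 : ‖⟪e i, y⟫_ℝ • e j - ⟪e j, y⟫_ℝ • e i‖ ^ 2 = ⟪e i, y⟫_ℝ ^ 2 + ⟪e j, y⟫_ℝ ^ 2 := by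
      rw [norm_sub_sq_real]
      simp [inner_smul_left, inner_smul_right, ho, hij.symm, norm_smul]
    have h2 : ∑ k ∈ {i, j}, ‖⟪e k, y⟫_ℝ‖ ^ 2 ≤ ‖y‖ ^ 2 :=
      e.orthonormal.sum_inner_products_le y
    rw [Finset.sum_pair hij] at h2
    simpa [h1] using h2
  · simp [ho, hij.symm]
  · simp [ho, hij]
  · simp [ho, Ne.symm hki, Ne.symm hkj]

/-- Let `b i` be the rows of a matrix `B` with positive diagonal `⟪b i, e i⟫`. There is a
contraction `U` such that `B * U` becomes symmetric after multiplying its rows by positive numbers,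
and such that its diagonal is at least half of that of `B`.

`U` is a maximizer of `∏ i, (⟪b i, U (e i)⟫ - ⟪b i, e i⟫ / 2)`, and the symmetry is the vanishing of
the derivative along rotations of the planes spanned by two basis vectors. -/
theorem exists_symmetrizing_contraction (e : OrthonormalBasis ι ℝ E) (b : ι → E)
    (hb : ∀ i, 0 < ⟪b i, e i⟫_ℝ) :
    ∃ U : E →L[ℝ] E, ‖U‖ ≤ 1 ∧ ∃ s : ι → ℝ, (∀ i, 0 < s i) ∧
      (∀ i j, s i * ⟪b i, U (e j)⟫_ℝ = s j * ⟪b j, U (e i)⟫_ℝ) ∧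
      ∀ i, ⟪b i, e i⟫_ℝ / 2 ≤ ⟪b i, U (e i)⟫_ℝ := by
  classical
  have : FiniteDimensional ℝ E := Module.Basis.finiteDimensional_of_finite e.toBasis
  have : ProperSpace (E →L[ℝ] E) := FiniteDimensional.proper_real _
  let β : ι → (E →L[ℝ] E) → ℝ := fun i U => ⟪b i, U (e i)⟫_ℝ - ⟪b i, e i⟫_ℝ / 2
  have hβ : ∀ i, Continuous (β i) := fun i => by fun_prop
  let K : Set (E →L[ℝ] E) := Metric.closedBall 0 1 ∩ {U | ∀ i, 0 ≤ β i U}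
  have hK : IsCompact K := by
    refine (isCompact_closedBall _ _).inter_right ?_
    simp only [Set.ofPred_forall]
    exact isClosed_iInter fun i => isClosed_le continuous_const (hβ i)
  have hid : ∀ i, 0 < β i (ContinuousLinearMap.id ℝ E) := fun i => by
    have := hb i
    simp only [β, ContinuousLinearMap.id_apply]
    linarith
  have hidK : ContinuousLinearMap.id ℝ E ∈ K :=
    ⟨by simpa using ContinuousLinearMap.norm_id_le, fun i => (hid i).le⟩
  obtain ⟨U, hUK, hU⟩ := hK.exists_isMaxOn ⟨_, hidK⟩
    (continuous_finsetProd Finset.univ fun i _ => hβ i).continuousOn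
  have hU1 : ‖U‖ ≤ 1 := by simpa using hUK.1
  have hprod : 0 < ∏ i, β i U :=
    (Finset.prod_pos fun i _ => hid i).trans_le (hU hidK)
  have hpos : ∀ i, 0 < β i U := fun i =>
    lt_of_le_of_ne (hUK.2 i) fun h0 => hprod.ne' (Finset.prod_eq_zero (Finset.mem_univ i) h0.symm)
  refine ⟨U, hU1, fun i => (β i U)⁻¹, fun i => inv_pos.2 (hpos i), fun i j => ?_, fun i => ?_⟩
  swap
  · have := hpos i
    simp only [β] at this
    linarith
  rcases eq_or_ne i j with rfl | hij
  · rfl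
  obtain ⟨T, hskew, hT, hTi, hTj, hTk⟩ := exists_skew_contraction e hij
  let R : ℝ → E →L[ℝ] E := fun θ => (√(1 + θ ^ 2))⁻¹ • (ContinuousLinearMap.id ℝ E + θ • T)
  have hR0 : U ∘L R 0 = U := by ext; simp [R]
  have hder : ∀ k, HasDerivAt (fun θ => β k (U ∘L R θ)) ⟪b k, U (T (e k))⟫_ℝ 0 := by
    intro k
    have h1 : HasDerivAt (fun θ : ℝ => 1 + θ ^ 2) 0 0 := by
      simpa using ((hasDerivAt_id (0 : ℝ)).pow 2).const_add 1
    have h2 : HasDerivAt (fun θ : ℝ => (√(1 + θ ^ 2))⁻¹) 0 0 := by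
      simpa using (h1.sqrt (by norm_num)).fun_inv (by norm_num)
    have h3 : HasDerivAt (fun θ : ℝ => ⟪b k, U (e k)⟫_ℝ + θ * ⟪b k, U (T (e k))⟫_ℝ)
        ⟪b k, U (T (e k))⟫_ℝ 0 := by
      simpa using ((hasDerivAt_id (0 : ℝ)).mul_const ⟪b k, U (T (e k))⟫_ℝ).const_add
        ⟪b k, U (e k)⟫_ℝ
    have h4 := (h2.fun_mul h3).sub_const (⟪b k, e k⟫_ℝ / 2)
    simpa [β, R, inner_add_right, inner_smul_right, mul_add] using h4
  have hmax : IsLocalMax (fun θ => ∑ k, Real.log (β k (U ∘L R θ))) 0 := by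
    have hev : ∀ᶠ θ in 𝓝 (0 : ℝ), ∀ k, 0 < β k (U ∘L R θ) :=
      eventually_all.2 fun k => (hder k).continuousAt.eventually_const_lt
        (by simpa only [hR0] using hpos k)
    filter_upwards [hev] with θ hθ
    rw [hR0, ← Real.log_prod fun k _ => (hθ k).ne', ← Real.log_prod fun k _ => (hpos k).ne']
    refine Real.log_le_log (Finset.prod_pos fun k _ => hθ k) (hU ⟨?_, fun k => (hθ k).le⟩)
    have := U.opNorm_comp_le (R θ)
    have h2 : ‖R θ‖ ≤ 1 := norm_smul_id_add_smul_le_one T hskew hT θ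
    simpa using this.trans (mul_le_one₀ hU1 (norm_nonneg _) h2)
  have hzero := hmax.hasDerivAt_eq_zero
    (HasDerivAt.fun_sum fun k _ => (hder k).log (by rw [hR0]; exact (hpos k).ne'))
  simp only [hR0] at hzero
  rw [← Finset.sum_subset (Finset.subset_univ {i, j}), Finset.sum_pair hij, hTi, hTj] at hzero
  · simp only [map_neg, inner_neg_right] at hzero
    rw [inv_mul_eq_div, inv_mul_eq_div]
    linarith [neg_div (β j U) ⟪b j, U (e i)⟫_ℝ]
  · intro k _ hk
    simp only [Finset.mem_insert, Finset.mem_singleton, not_or] at hk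
    simp [hTk k hk.1 hk.2]

/-- Bang's lemma without symmetry: it is applied to the symmetrized matrix, and the contraction does
not increase the Euclidean norm of the solution. -/
theorem exists_forall_le_abs_inner (e : OrthonormalBasis ι ℝ E) (b : ι → E)
    (hb : ∀ i, 0 < ⟪b i, e i⟫_ℝ) (τ : ι → ℝ) :
    ∃ z : E, ‖z‖ ^ 2 ≤ ∑ i, τ i ^ 2 ∧ ∀ i, ⟪b i, e i⟫_ℝ / 2 * |τ i| ≤ |⟪b i, z⟫_ℝ| := by
  obtain ⟨U, hU, s, hs, hsymm, hdiag⟩ := exists_symmetrizing_contraction e b hb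
  obtain ⟨t, ht, hmain⟩ := exists_bang_signs (fun i j => s i * ⟪b i, U (e j)⟫_ℝ) hsymm τ
  refine ⟨U (∑ j, t j • e j), ?_, fun i => ?_⟩
  · calc ‖U (∑ j, t j • e j)‖ ^ 2 ≤ ‖∑ j, t j • e j‖ ^ 2 := by
          have := U.le_of_opNorm_le hU (∑ j, t j • e j)
          rw [one_mul] at this
          gcongr
      _ = ∑ i, τ i ^ 2 := by
          rw [← real_inner_self_eq_norm_sq, e.orthonormal.inner_sum]
          simp [← ht, sq]
  · have h := hmain i
    have hsum : ∑ j, s i * ⟪b i, U (e j)⟫_ℝ * t j = s i * ⟪b i, U (∑ j, t j • e j)⟫_ℝ := by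
      simp only [map_sum, map_smul, inner_sum, inner_smul_right, Finset.mul_sum]
      exact Finset.sum_congr rfl fun j _ => by ring
    rw [hsum] at h
    set q := ⟪b i, U (∑ j, t j • e j)⟫_ℝ
    have hti : |t i| = |τ i| := (sq_eq_sq_iff_abs_eq_abs _ _).1 (ht i)
    have h1 : ⟪b i, U (e i)⟫_ℝ * t i ^ 2 ≤ t i * q := by
      have : s i * (⟪b i, U (e i)⟫_ℝ * t i ^ 2) ≤ s i * (t i * q) := by linarith
      exact le_of_mul_le_mul_left this (hs i)
    have h2 : ⟪b i, e i⟫_ℝ / 2 * |t i| * |t i| ≤ |q| * |t i| := by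
      rw [mul_assoc, abs_mul_abs_self, ← abs_mul]
      calc _ ≤ ⟪b i, U (e i)⟫_ℝ * t i ^ 2 := by rw [sq]; gcongr; exacts [mul_self_nonneg _, hdiag i]
        _ ≤ t i * q := h1
        _ ≤ |q * t i| := by rw [mul_comm]; exact le_abs_self _
    rw [← hti]
    rcases eq_or_ne (t i) 0 with h0 | h0
    · simp [h0]
    · exact le_of_mul_le_mul_right h2 (abs_pos.2 h0)

/-- The plank theorem in matrix form, with constant `1 / 2`. -/
theorem exists_sum_abs_le_forall_le_abs_sum (A : ι → ι → ℝ) (hA : ∀ i, A i i = 1) (w : ι → ℝ)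
    (hw : ∀ i, 0 < w i) :
    ∃ c : ι → ℝ, ∑ j, |c j| ≤ ∑ j, w j ∧ ∀ i, w i / 2 ≤ |∑ j, A i j * c j| := by
  classical
  -- the columns are scaled by `√w`, which is also the vector whose signs are chosen, so that the
  -- Cauchy–Schwarz inequality bounds the `ℓ₁`-norm of the solution
  obtain ⟨z, hz, hmain⟩ := exists_forall_le_abs_inner (EuclideanSpace.basisFun ι ℝ)
    (fun i => WithLp.toLp 2 fun j => A i j * √(w j))
    (fun i => by simp [EuclideanSpace.inner_single_right, hA, hw]) (fun i => √(w i))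
  have hsq : ∀ i, √(w i) ^ 2 = w i := fun i => Real.sq_sqrt (hw i).le
  simp only [hsq] at hz
  refine ⟨fun j => √(w j) * z j, ?_, fun i => ?_⟩
  · have hcs := Finset.sum_mul_sq_le_sq_mul_sq Finset.univ (fun j => √(w j)) (fun j => |z j|)
    simp only [hsq, sq_abs] at hcs
    rw [EuclideanSpace.real_norm_sq_eq] at hz
    have hw0 : 0 ≤ ∑ j, w j := Finset.sum_nonneg fun j _ => (hw j).le
    simp only [abs_mul, abs_of_nonneg (Real.sqrt_nonneg _)]
    refine abs_le_of_sq_le_sq' (hcs.trans ?_) hw0 |>.2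
    rw [sq]
    gcongr
  · have h := hmain i
    have e1 : ⟪(WithLp.toLp 2 fun j => A i j * √(w j) : EuclideanSpace ℝ ι), z⟫_ℝ
        = ∑ j, A i j * (√(w j) * z j) := by
      rw [PiLp.inner_apply]
      exact Finset.sum_congr rfl fun j _ => by simp; ring
    have e2 : ⟪(WithLp.toLp 2 fun j => A i j * √(w j) : EuclideanSpace ℝ ι),
        EuclideanSpace.basisFun ι ℝ i⟫_ℝ = √(w i) := by
      simp [EuclideanSpace.inner_single_right, hA]
    rw [e1, e2, abs_of_nonneg (Real.sqrt_nonneg _)] at h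
    refine le_trans (le_of_eq ?_) h
    rw [div_mul_eq_mul_div, ← sq, hsq]

end Plank

/-! ### Functionals bounded below on a sequence -/

section Functional

variable {𝕜 : Type*} [RCLike 𝕜] {X : Type*} [NormedAddCommGroup X] [NormedSpace 𝕜 X]

/-- The functional is a real combination of norming functionals of the `x i`; the plank theorem is
applied to the real parts of their values, with widths `‖x i‖⁻¹`. -/
theorem exists_norm_le_forall_half_le_norm {ι : Type*} [Fintype ι] (x : ι → X)
    (hx : ∀ i, x i ≠ 0) :
    ∃ f : X →L[𝕜] 𝕜, ‖f‖ ≤ ∑ i, ‖x i‖⁻¹ ∧ ∀ i, 1 / 2 ≤ ‖f (x i)‖ := by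
  have hpos : ∀ i, 0 < ‖x i‖ := fun i => norm_pos_iff.2 (hx i)
  choose g hg1 hg using fun i => exists_dual_vector 𝕜 (x i) (hpos i).ne'
  obtain ⟨c, hc, hmain⟩ := exists_sum_abs_le_forall_le_abs_sum
    (fun i j => ‖x i‖⁻¹ * RCLike.re (g j (x i)))
    (fun i => by simp [hg, (hpos i).ne']) (fun i => ‖x i‖⁻¹) (fun i => inv_pos.2 (hpos i))
  refine ⟨∑ j, (c j : 𝕜) • g j, ?_, fun i => ?_⟩
  · refine (norm_sum_le _ _).trans (le_trans (le_of_eq ?_) hc)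
    simp [norm_smul, hg1]
  · have h := hmain i
    have e : ∑ j, ‖x i‖⁻¹ * RCLike.re (g j (x i)) * c j
        = ‖x i‖⁻¹ * RCLike.re ((∑ j, (c j : 𝕜) • g j) (x i)) := by
      simp only [sum_apply, smul_apply, smul_eq_mul,
        map_sum, RCLike.re_ofReal_mul, Finset.mul_sum]
      exact Finset.sum_congr rfl fun j _ => by ring
    rw [e, abs_mul, abs_of_pos (inv_pos.2 (hpos i)), div_eq_mul_inv] at h
    have h' := le_of_mul_le_mul_left h (inv_pos.2 (hpos i))
    rw [one_div]
    exact h'.trans (RCLike.abs_re_le_norm _)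

/-- If the reciprocals of the norms are summable, a single functional is bounded below on the whole
sequence. This follows from the finite version the finite one by weak-* compactness of balls. -/
theorem exists_forall_half_le_norm_of_summable (x : ℕ → X) (hx : ∀ n, x n ≠ 0)
    (hsum : Summable fun n => ‖x n‖⁻¹) :
    ∃ f : X →L[𝕜] 𝕜, ∀ n, 1 / 2 ≤ ‖f (x n)‖ := by
  let B : Set (WeakDual 𝕜 X) :=
    WeakDual.toStrongDual ⁻¹' Metric.closedBall 0 (∑' n, ‖x n‖⁻¹)
  have hB : IsCompact B := WeakDual.isCompact_closedBall _ _
  obtain ⟨f, -, hf⟩ := hB.inter_iInter_nonempty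
    (fun n => {f : WeakDual 𝕜 X | 1 / 2 ≤ ‖f (x n)‖})
    (fun n => isClosed_le continuous_const (WeakDual.eval_continuous (x n)).norm) (by
      intro u
      obtain ⟨f, hfn, hf⟩ := exists_norm_le_forall_half_le_norm (𝕜 := 𝕜)
        (fun i : u => x i) (fun i => hx i)
      refine ⟨StrongDual.toWeakDual f, ?_, ?_⟩
      · have : ∑ i : u, ‖x i‖⁻¹ ≤ ∑' n, ‖x n‖⁻¹ := by
          rw [Finset.sum_coe_sort u fun n => ‖x n‖⁻¹]
          exact hsum.sum_le_tsum u fun n _ => by positivity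
        simpa [B] using hfn.trans this
      · simp only [Set.mem_iInter]
        exact fun n hn => hf ⟨n, hn⟩)
  refine ⟨WeakDual.toStrongDual f, fun n => ?_⟩
  exact Set.mem_iInter.1 hf n

theorem not_summable_inv_norm_of_hasZeroAsWeakClusterPoint (x : ℕ → X) (hx : ∀ n, x n ≠ 0)
    (h : HasZeroAsWeakClusterPoint 𝕜 x) : ¬ Summable fun n => ‖x n‖⁻¹ := by
  intro hsum
  obtain ⟨f, hf⟩ := exists_forall_half_le_norm_of_summable (𝕜 := 𝕜) x hx hsum
  have hcont : Continuous fun y : WeakSpace 𝕜 X => f ((toWeakSpace 𝕜 X).symm y) :=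
    WeakBilin.eval_continuous _ f
  have hnhds : {y : WeakSpace 𝕜 X | ‖f ((toWeakSpace 𝕜 X).symm y)‖ < 1 / 2} ∈ 𝓝 0 :=
    (isOpen_lt hcont.norm continuous_const).mem_nhds (by simp)
  obtain ⟨n, hn⟩ := (h.frequently hnhds).exists
  simp only [LinearEquiv.symm_apply_apply] at hn
  exact absurd (hf n) hn.not_ge

/-! ### Matrices of weights and weak cluster points -/

theorem hasZeroAsWeakClusterPoint_of_weaklyPConvergesToZero {P : ℕ → ℕ → ℝ} {x : ℕ → X}
    (hP : IsWeightMatrix P) (h : WeaklyPConvergesToZero 𝕜 P 1 x) :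
    HasZeroAsWeakClusterPoint 𝕜 x := by
  have hfin : ∀ (n : ℕ) (a : ℕ → ℝ), Summable fun m => P n m * a m := fun n a =>
    summable_of_hasFiniteSupport ((hP.finite_rows n).subset fun m hm h0 => hm (by simp [h0]))
  refine mapClusterPt_iff_frequently.2 fun V hV => ?_
  obtain ⟨W, hW, hWV⟩ :=
    (LinearMap.hasBasis_weakBilin (topDualPairing 𝕜 X).flip).mem_iff.1 hV
  obtain ⟨s, r, hr, rfl⟩ := (SeminormFamily.basisSets_iff _).1 hW
  by_contra hcon
  obtain ⟨M, hM⟩ := eventually_atTop.1 (not_frequently.1 hcon)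
  let q : ℕ → ℝ := fun m => ∑ f ∈ s, ‖f (x m)‖ ^ (1 : ℝ)
  have hq0 : ∀ m, 0 ≤ q m := fun m => Finset.sum_nonneg fun f _ => by positivity
  have hq : ∀ m, M ≤ m → r ≤ q m := by
    intro m hm
    by_contra hlt
    refine hM m hm (hWV ((Seminorm.mem_ball_zero _).2 ?_))
    refine Seminorm.finset_sup_apply_lt hr fun f hf => ?_
    refine lt_of_le_of_lt ?_ (not_le.1 hlt)
    have := Finset.single_le_sum (f := fun f : X →L[𝕜] 𝕜 => ‖f (x m)‖ ^ (1 : ℝ))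
      (fun f _ => by positivity) hf
    simp only [Real.rpow_one] at this
    simp only [q, Real.rpow_one]
    exact this
  have hlim : Tendsto (fun n => ∑' m, P n m * q m) atTop (𝓝 0) := by
    have h1 := tendsto_finsetSum s fun f _ => h f
    simp only [Finset.sum_const_zero] at h1
    refine h1.congr fun n => ?_
    rw [← Summable.tsum_finsetSum fun f _ => hfin n _]
    simp only [q, Finset.mul_sum]
  -- the first `M` columns carry a vanishing part of the weight of the rows
  have hcol : Tendsto (fun n => ∑' m, P n m * (if m < M then r else 0)) atTop (𝓝 0) := by
    have h1 := tendsto_finsetSum (Finset.range M) fun m _ => (hP.column_tendsto m).mul_const r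
    simp only [zero_mul, Finset.sum_const_zero] at h1
    refine h1.congr fun n => ?_
    rw [tsum_eq_sum (s := Finset.range M) fun m hm => by
      rw [if_neg (by simpa using hm), mul_zero]]
    exact Finset.sum_congr rfl fun m hm => by rw [if_pos (Finset.mem_range.1 hm)]
  have hle : ∀ n, r ≤ ∑' m, P n m * q m + ∑' m, P n m * (if m < M then r else 0) := by
    intro n
    rw [← (hfin n _).tsum_add (hfin n _)]
    calc r = ∑' m, P n m * r := by rw [tsum_mul_right, hP.row_sum, one_mul]
      _ ≤ _ := by
        refine (hfin n _).tsum_le_tsum (fun m => ?_) ((hfin n _).add (hfin n _))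
        rw [← mul_add]
        refine mul_le_mul_of_nonneg_left ?_ (hP.nonneg n m)
        split_ifs with hm
        · linarith [hq0 m]
        · linarith [hq m (not_lt.1 hm)]
  have h0 := ge_of_tendsto' (hlim.add hcol) hle
  linarith

/-! ### Blocks of almost `ℓ_∞` bases -/

/-- An upper `ℓ_∞`-estimate for a family dualizes to an `ℓ₁`-estimate for the values of a
functional. -/
theorem sum_norm_apply_le {ι : Type*} [Fintype ι] (e : ι → X) {C : ℝ}
    (he : ∀ b : ι → 𝕜, ‖∑ j, b j • e j‖ ≤ C * ‖b‖) (hC : 0 ≤ C) (f : X →L[𝕜] 𝕜) :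
    ∑ j, ‖f (e j)‖ ≤ C * ‖f‖ := by
  choose b hb1 hb using fun j => RCLike.exists_norm_eq_mul_self (f (e j))
  have hnorm : ‖b‖ ≤ 1 := (pi_norm_le_iff_of_nonneg zero_le_one).2 fun j => (hb1 j).le
  have heq : ((∑ j, ‖f (e j)‖ : ℝ) : 𝕜) = f (∑ j, b j • e j) := by
    simp [hb]
  calc ∑ j, ‖f (e j)‖ = ‖((∑ j, ‖f (e j)‖ : ℝ) : 𝕜)‖ := by
        rw [RCLike.norm_ofReal, abs_of_nonneg (Finset.sum_nonneg fun j _ => norm_nonneg _)]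
    _ ≤ ‖f‖ * ‖∑ j, b j • e j‖ := by rw [heq]; exact f.le_opNorm _
    _ ≤ ‖f‖ * (C * 1) := by
        gcongr
        exact (he b).trans (by gcongr)
    _ = C * ‖f‖ := by ring

theorem exists_blocks (c : ℕ → ℝ)
    (hc : Tendsto (fun N : ℕ => ∑ n ∈ Finset.range N, c n) atTop atTop) :
    ∃ b : ℕ → ℕ, b 0 = 0 ∧ Monotone b ∧
      ∀ k : ℕ, (k : ℝ) + 1 ≤ ∑ n ∈ Finset.Ico (b k) (b (k + 1)), c n := by
  have step : ∀ k m : ℕ, ∃ N, m ≤ N ∧ (k : ℝ) + 1 ≤ ∑ n ∈ Finset.Ico m N, c n := by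
    intro k m
    obtain ⟨N, hN, hmN⟩ := ((hc.eventually_ge_atTop
      ((k : ℝ) + 1 + ∑ n ∈ Finset.range m, c n)).and (eventually_ge_atTop m)).exists
    refine ⟨N, hmN, ?_⟩
    rw [Finset.sum_Ico_eq_sub _ hmN]
    linarith
  choose N hN1 hN2 using step
  exact ⟨fun k => Nat.rec 0 (fun k m => N k m) k, rfl, monotone_nat_of_le_succ fun k => hN1 k _,
    fun k => hN2 k _⟩

theorem exists_weaklyPConvergesToZero (hX : LinftyFinitelyRepresentable 𝕜 X) (a : ℕ → ℝ)
    (ha : ∀ n, 0 < a n)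
    (hsum : Tendsto (fun N : ℕ => ∑ n ∈ Finset.range N, (a n)⁻¹) atTop atTop) :
    ∃ x : ℕ → X, (∀ n, ‖x n‖ = a n) ∧
      ∃ P : ℕ → ℕ → ℝ, IsWeightMatrix P ∧ WeaklyPConvergesToZero 𝕜 P 1 x := by
  obtain ⟨b, hb0, hbmono, hb⟩ := exists_blocks _ hsum
  choose e he1 he using fun k : ℕ => hX 1 one_pos (b (k + 1))
  have hS : ∀ k, 0 < ∑ n ∈ Finset.Ico (b k) (b (k + 1)), (a n)⁻¹ := fun k =>
    lt_of_lt_of_le (by positivity) (hb k)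
  have hex : ∀ n, ∃ k, n < b (k + 1) := by
    intro n
    have hlt : StrictMono b := strictMono_nat_of_lt_succ fun k => by
      by_contra hcon
      have := hS k
      simp [Finset.Ico_eq_empty_of_le (not_lt.1 hcon)] at this
    exact ⟨n, (Nat.lt_succ_self n).trans_le (hlt.id_le _)⟩
  -- the index of the block that contains `n`
  let κ : ℕ → ℕ := fun n => Nat.find (hex n)
  have hκ : ∀ n, n < b (κ n + 1) := fun n => Nat.find_spec (hex n)
  have hκ_eq : ∀ k n, n ∈ Finset.Ico (b k) (b (k + 1)) → κ n = k := by
    intro k n hn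
    rw [Finset.mem_Ico] at hn
    refine (Nat.find_eq_iff _).2 ⟨hn.2, fun l hl => not_lt.2 ((hbmono hl).trans hn.1)⟩
  let S : ℕ → ℝ := fun k => ∑ n ∈ Finset.Ico (b k) (b (k + 1)), (a n)⁻¹
  let P : ℕ → ℕ → ℝ := fun k n => if n ∈ Finset.Ico (b k) (b (k + 1)) then (a n)⁻¹ / S k else 0
  have htsum : ∀ k (y : ℕ → ℝ),
      ∑' n, P k n * y n = (∑ n ∈ Finset.Ico (b k) (b (k + 1)), (a n)⁻¹ * y n) / S k := by
    intro k y
    rw [tsum_eq_sum (s := Finset.Ico (b k) (b (k + 1))) fun n hn => by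
      simp only [P, if_neg hn, zero_mul], Finset.sum_div]
    exact Finset.sum_congr rfl fun n hn => by simp only [P, if_pos hn]; ring
  let x : ℕ → X := fun n => ((a n : ℝ) : 𝕜) • e (κ n) ⟨n, hκ n⟩
  refine ⟨x, fun n => ?_, P, ⟨fun k n => ?_, fun k => ?_, fun k => ?_, fun n => ?_⟩, fun f => ?_⟩
  · simp [x, norm_smul, he1, abs_of_pos (ha n)]
  · simp only [P]
    split_ifs
    · exact div_nonneg (inv_nonneg.2 (ha n).le) (hS k).le
    · exact le_rfl
  · refine (Finset.Ico (b k) (b (k + 1))).finite_toSet.subset fun n hn => ?_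
    by_contra hcon
    exact hn (if_neg hcon)
  · have := htsum k fun _ => 1
    simp only [mul_one] at this
    rw [this]
    exact div_self (hS k).ne'
  · refine tendsto_const_nhds.congr' ?_
    filter_upwards [eventually_gt_atTop (κ n)] with k hk
    exact (if_neg fun hn => hk.ne (hκ_eq k n hn)).symm
  · have hbound : ∀ k, ∑' n, P k n * ‖f (x n)‖ ^ (1 : ℝ) ≤ 2 * ‖f‖ / ((k : ℝ) + 1) := by
      intro k
      rw [htsum]
      have h1 : ∑ n ∈ Finset.Ico (b k) (b (k + 1)), (a n)⁻¹ * ‖f (x n)‖ ^ (1 : ℝ) ≤ 2 * ‖f‖ := by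
        have h2 := sum_norm_apply_le (e k) (fun c => (he k c).2) (by norm_num) f
        let F : ℕ → ℝ := fun n => if h : n < b (k + 1) then ‖f (e k ⟨n, h⟩)‖ else 0
        have hF : ∑ j, ‖f (e k j)‖ = ∑ n ∈ Finset.range (b (k + 1)), F n := by
          rw [← Fin.sum_univ_eq_sum_range]
          simp [F]
        calc _ = ∑ n ∈ Finset.Ico (b k) (b (k + 1)), F n := by
              refine Finset.sum_congr rfl fun n hn => ?_
              obtain rfl := hκ_eq k n hn
              simp [x, F, hκ n, abs_of_pos (ha n), (ha n).ne']
          _ ≤ ∑ n ∈ Finset.range (b (k + 1)), F n := by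
              refine Finset.sum_le_sum_of_subset_of_nonneg (fun n hn => ?_) fun n _ _ => ?_
              · exact Finset.mem_range.2 (Finset.mem_Ico.1 hn).2
              · simp only [F]
                split_ifs <;> positivity
          _ ≤ 2 * ‖f‖ := by rw [← hF]; linarith
      exact div_le_div₀ (by positivity) h1 (by positivity) (hb k)
    refine squeeze_zero (fun k => ?_) hbound ?_
    · rw [htsum]
      exact div_nonneg (Finset.sum_nonneg fun n _ =>
        mul_nonneg (inv_nonneg.2 (ha n).le) (by positivity)) (hS k).le
    · simpa [div_eq_mul_inv] using
        (tendsto_one_div_add_atTop_nhds_zero_nat (𝕜 := ℝ)).const_mul (2 * ‖f‖)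

end Functional

end WeakCluster

theorem mainTheorem4 {𝕜 : Type*} [RCLike 𝕜] {X : Type*} [NormedAddCommGroup X]
    [NormedSpace 𝕜 X] [CompleteSpace X]
    (hX : WeakCluster.LinftyFinitelyRepresentable 𝕜 X)
    (a : ℕ → ℝ) (ha : ∀ n, 0 < a n) :
    List.TFAE [
      ∃ x : ℕ → X, (∀ n, ‖x n‖ = a n) ∧
        ∃ P : ℕ → ℕ → ℝ, WeakCluster.IsWeightMatrix P ∧
          WeakCluster.WeaklyPConvergesToZero 𝕜 P 1 x,
      ∃ x : ℕ → X, (∀ n, ‖x n‖ = a n) ∧ WeakCluster.HasZeroAsWeakClusterPoint 𝕜 x,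
      Tendsto (fun N : ℕ => ∑ n ∈ Finset.range N, (a n)⁻¹) atTop atTop] := by
  tfae_have 1 → 2
  | ⟨x, hx, P, hP, h⟩ =>
    ⟨x, hx, WeakCluster.hasZeroAsWeakClusterPoint_of_weaklyPConvergesToZero hP h⟩
  tfae_have 2 → 3 := by
    rintro ⟨x, hx, h⟩
    have hx0 : ∀ n, x n ≠ 0 := fun n => norm_pos_iff.1 (by rw [hx]; exact ha n)
    have := WeakCluster.not_summable_inv_norm_of_hasZeroAsWeakClusterPoint x hx0 h
    simp only [hx] at this
    exact (not_summable_iff_tendsto_nat_atTop_of_nonneg fun n => (inv_pos.2 (ha n)).le).1 this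
  tfae_have 3 → 1 := WeakCluster.exists_weaklyPConvergesToZero hX a ha
  tfae_finish
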